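/- **Setting.** A Restricted Boltzmann Machine (RBM) with observed variables $X\in\{-1,1\}^n$ and latent variables $Y\in\{-1,1\}^m$ is the distribution $$\mathbb P(X=x,Y=y)\propto\exp\left(x^TJy+h^Tx+g^Ty\right),\qquad J\in\mathbb R^{n\times m},\ h\in\mathbb R^n,\ g\in\mathbb R^m .$$ The marginal distribution of $X$ satisfies $\mathbb P(X=x)\propto e^{f(x)}$ with $$f(x)=\sum_{j=1}^m\rho\Big(\sum_{i=1}^n J_{i,j}x_i+g_j\Big)+h^Tx,\qquad \rho(t)=\log(e^t+e^{-t}).$$ Write $f(x)=\sum_{T\subseteq[n]}\hat f(T)\prod_{i\in T}x_i$. The MRF neighborhood of $u\in[n]$ is the set $N(u)$ of all $i\ne u$ for which there is $T\subseteq[n]$ with $u,i\in T$ and $\hat f(T)\neq0$. Let * $d$ be the maximum over $j\in[m]$ of $|\{i\in[n]: J_{i,j}\ne0\}|$, and $D=\max_{u}|N(u)|$; * $s$ be the maximum over $u\in[n]$ of the number of $j\in[m]$ such that $J_{i,j}\neq0$ for some $i\in N(u)$; * $\alpha=\min\{|\hat f(T)|: T\neq\emptyset,\ \hat f(T)\ne0\}$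 and $\gamma=\max_{u\in[n]}\sum_{T\ni u}|\hat f(T)|$. For $u\in[n]$ and $I,S\subseteq[n]$ let $$\nu_{u,I|S}=\mathbb E_{R,G}\Big[\mathbb E_{X_S}\big[\,\big|\mathbb P(X_u=R,X_I=G\mid X_S)-\mathbb P(X_u=R\mid X_S)\,\mathbb P(X_I=G\mid X_S)\big|\,\big]\Big],$$ where $R$ and $G$ are uniform on $\{-1,1\}$ and $\{-1,1\}^{I}$. Finally let $$\tau=\frac12\cdot\frac{4\alpha^2(e^{-2\gamma})^{d+D-1}}{d^{4d}\,2^{d+1}\binom{D}{d-1}\gamma e^{2\gamma}},\qquad \tau'=\frac1{(4d)^{2^s}}\Big(\frac1d\Big)^{2^s(2^s+1)}\tau .$$ **Theorem.** Let $u$ be an observed variable and let $S\subseteq[n]$ be such that $u\notin S$ and $N(u)\not\subseteq S$. Assume $d-1\le D$, so that $\binom{D}{d-1}\neq0$ and $\tau'$ is defined. Then there is a set $I\subseteq N(u)$, disjoint from $S$, with $|I|\le2^s$ and $$\nu_{u,I|S}\ \ge\ \frac1{(4d)^{2^s}}\Big(\frac1d\Big)^{2^s(2^s+1)}\frac{4\alpha^2(e^{-2\gamma})^{d+D-1}}{d^{4d}\,2^{d+1}\binom{D}{d-1}\gamma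 e^{2\gamma}}\ =\ 2\tau' .$$ -/

import Mathlib

/-- Assignments of `k` spins; the unit group `ℤˣ` is the two-element set `{-1, 1}`. -/
abbrev SpinConfig (k : ℕ) : Type := Fin k → ℤˣ

/-- The real value `-1` or `1` of a spin. -/
def spinVal (a : ℤˣ) : ℝ := ((a : ℤ) : ℝ)

/-- Parameters of a Restricted Boltzmann Machine with `n` observed and `m` latent variables:
interaction matrix and external fields. -/
structure RBM (n m : ℕ) where
  /-- the `n × m` interaction matrix -/
  J : Fin n → Fin m → ℝ
  /-- external field on the observed variables -/
  h : Fin n → ℝ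
  /-- external field on the latent variables -/
  g : Fin m → ℝ

namespace RBM

variable {n m : ℕ}

/-- The unnormalized weight `exp (xᵀ J y + hᵀ x + gᵀ y)`. -/
noncomputable def weight (B : RBM n m) (x : SpinConfig n) (y : SpinConfig m) : ℝ :=
  Real.exp ((∑ i, ∑ j, spinVal (x i) * B.J i j * spinVal (y j))
    + (∑ i, B.h i * spinVal (x i)) + ∑ j, B.g j * spinVal (y j))

/-- The joint probability mass function `ℙ(X = x, Y = y)`. -/
noncomputable def jointProb (B : RBM n m) (x : SpinConfig n) (y : SpinConfig m) : ℝ :=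
  B.weight x y / ∑ x' : SpinConfig n, ∑ y' : SpinConfig m, B.weight x' y'

/-- The marginal probability mass function `ℙ(X = x)` of the observed variables. -/
noncomputable def obsProb (B : RBM n m) (x : SpinConfig n) : ℝ :=
  ∑ y : SpinConfig m, B.jointProb x y

/-- The probability `ℙ(X ∈ E)` of an event on the observed variables. -/
noncomputable def prob (B : RBM n m) (E : Set (SpinConfig n)) : ℝ :=
  ∑ x : SpinConfig n, E.indicator B.obsProb x

/-- The conditional probability `ℙ(X ∈ E | X ∈ F)`. -/
noncomputable def condProb (B : RBM n m) (E F : Set (SpinConfig n)) : ℝ :=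
  B.prob (E ∩ F) / B.prob F

/-- `ρ(t) = log (exp t + exp (-t))`. -/
noncomputable def rho (t : ℝ) : ℝ := Real.log (Real.exp t + Real.exp (-t))

/-- The function `f` with `ℙ(X = x) ∝ exp (f x)`, see `obsProb_eq_exp_energy`. -/
noncomputable def energy (B : RBM n m) (x : SpinConfig n) : ℝ :=
  (∑ j, rho ((∑ i, B.J i j * spinVal (x i)) + B.g j)) + ∑ i, B.h i * spinVal (x i)

/-- Summing the joint weight over the latent variables gives `exp (f x)`. -/
theorem sum_weight_eq_exp_energy (B : RBM n m) (x : SpinConfig n) :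
    ∑ y : SpinConfig m, B.weight x y = Real.exp (B.energy x) := by
  have hw : ∀ y : SpinConfig m, B.weight x y
      = Real.exp (∑ i, B.h i * spinVal (x i))
        * ∏ j, Real.exp (((∑ i, B.J i j * spinVal (x i)) + B.g j) * spinVal (y j)) := by
    intro y
    rw [← Real.exp_sum, ← Real.exp_add, weight, Finset.sum_comm]
    congr 1
    simp only [add_mul, Finset.sum_add_distrib, Finset.sum_mul]
    have : ∀ j i, spinVal (x i) * B.J i j * spinVal (y j)
        = B.J i j * spinVal (x i) * spinVal (y j) := fun j i => by ring
    simp only [this]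
    ring
  have hrho : ∀ t : ℝ, Real.exp (rho t) = ∑ a : ℤˣ, Real.exp (t * spinVal a) := by
    intro t
    rw [rho, Real.exp_log (by positivity)]
    have hu : (Finset.univ : Finset ℤˣ) = {1, -1} := by decide
    rw [hu, Finset.sum_pair (by decide)]
    simp [spinVal]
  simp only [hw]
  rw [← Finset.mul_sum, energy, Real.exp_add, mul_comm]
  congr 1
  rw [Real.exp_sum, Finset.prod_congr rfl fun j _ => hrho _]
  exact (Fintype.prod_sum (fun (j : Fin m) (a : ℤˣ) =>
    Real.exp (((∑ i, B.J i j * spinVal (x i)) + B.g j) * spinVal a))).symm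

/-- The observed variables form a Markov Random Field with `ℙ(X = x) ∝ exp (f x)`. -/
theorem obsProb_eq_exp_energy (B : RBM n m) (x : SpinConfig n) :
    B.obsProb x = Real.exp (B.energy x) / ∑ x' : SpinConfig n, Real.exp (B.energy x') := by
  simp only [obsProb, jointProb, ← Finset.sum_div, sum_weight_eq_exp_energy]

/-- The Fourier coefficient of `f` at `T`, i.e. the coefficient of the monomial `∏ i ∈ T, x i`
in the multilinear representation of `f`. It is the potential of the clique `T`. -/
noncomputable def fourier (B : RBM n m) (T : Finset (Fin n)) : ℝ :=
  (1 / 2 ^ n) * ∑ x : SpinConfig n, B.energy x * ∏ i ∈ T, spinVal (x i)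

open Classical in
/-- The MRF neighborhood of the observed variable `u`. -/
noncomputable def nbhd (B : RBM n m) (u : Fin n) : Finset (Fin n) :=
  {i | i ≠ u ∧ ∃ T : Finset (Fin n), u ∈ T ∧ i ∈ T ∧ B.fourier T ≠ 0}

/-- `D`: the maximum degree of a variable in the MRF of the observed variables. -/
noncomputable def mrfDegree (B : RBM n m) : ℕ :=
  Finset.univ.sup fun u => (B.nbhd u).card

/-- `α`: the minimum absolute value of a non-zero potential. The constant term of `f`,
which does not affect the distribution, is not a potential. -/
noncomputable def minPotential (B : RBM n m) : ℝ :=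
  sInf {a : ℝ | ∃ T : Finset (Fin n), T.Nonempty ∧ B.fourier T ≠ 0 ∧ a = |B.fourier T|}

open Classical in
/-- `γ`: the width of the MRF of the observed variables. -/
noncomputable def width (B : RBM n m) : ℝ :=
  ⨆ u : Fin n, ∑ T : Finset (Fin n) with u ∈ T, |B.fourier T|

open Classical in
/-- `d`: the maximum degree of a latent variable in the RBM. -/
noncomputable def latentDegree (B : RBM n m) : ℕ :=
  Finset.univ.sup fun j : Fin m => (Finset.univ.filter fun i : Fin n => B.J i j ≠ 0).card

open Classical in
/-- `s`: the maximum number of latent variables connected to the MRF neighborhood of an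
observed variable. -/
noncomputable def sparsity (B : RBM n m) : ℕ :=
  Finset.univ.sup fun u : Fin n =>
    (Finset.univ.filter fun j : Fin m => ∃ i ∈ B.nbhd u, B.J i j ≠ 0).card

/-- `ν_{u,I|S}`: the average over uniform `R ∈ {-1,1}` and `G ∈ {-1,1}^I` of
`𝔼_{X_S} |ℙ(X_u = R, X_I = G | X_S) - ℙ(X_u = R | X_S) ℙ(X_I = G | X_S)|`. -/
noncomputable def nu (B : RBM n m) (u : Fin n) (I S : Finset (Fin n)) : ℝ :=
  (1 / 2) * ∑ R : ℤˣ, (1 / 2 ^ I.card) * ∑ G : I → ℤˣ, ∑ z : S → ℤˣ,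
    B.prob {x | S.restrict x = z} *
      |B.condProb {x | x u = R ∧ I.restrict x = G} {x | S.restrict x = z}
        - B.condProb {x | x u = R} {x | S.restrict x = z}
          * B.condProb {x | I.restrict x = G} {x | S.restrict x = z}|

/-- The threshold `τ`. -/
noncomputable def tau (B : RBM n m) : ℝ :=
  (1 / 2) * ((4 * B.minPotential ^ 2
      * Real.exp (-2 * B.width) ^ (B.latentDegree + B.mrfDegree - 1)) /
    ((B.latentDegree : ℝ) ^ (4 * B.latentDegree) * 2 ^ (B.latentDegree + 1)
      * (B.mrfDegree.choose (B.latentDegree - 1) : ℝ) * B.width * Real.exp (2 * B.width)))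

/-- The threshold `τ'`. -/
noncomputable def tauPrime (B : RBM n m) : ℝ :=
  (1 / (4 * (B.latentDegree : ℝ)) ^ (2 ^ B.sparsity))
    * (1 / (B.latentDegree : ℝ)) ^ (2 ^ B.sparsity * (2 ^ B.sparsity + 1)) * B.tau

end RBM

/-! Let `g` be the influence of `u`, half the discrete derivative of `f` in direction `u`. The proof
bounds the averaged conditional covariance of `g` and `X_u` given `X_S` from both sides.

Lower bound. Given all other spins, `X_u` has mean `tanh g`, and `tanh` has slope at least `exp
(-2γ)` on `[-γ, γ]`. Hence the covariance is at least `exp (-2γ)` times the mean conditional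
variance of `g` (`exp_mul_expect_sq_le`). Take a support set `T` that contains `u` and a neighbor
outside `S` and is maximal under inclusion. Rerandomizing the spins in `T.erase u` costs a factor
`exp (-2γ)` per spin and exposes the Fourier coefficient of `T`, so the variance is at least `exp
(-2γ) ^ (|T| - 1) * α ^ 2` (`exp_pow_mul_sq_le_expect_sq`).

Upper bound. Expanding `g` in monomials bounds the covariance by `γ` times the largest covariance of
`X_u` with a monomial outside `S`, of degree at most `d - 1`. Given `Y` the observed spins are
independent, so such a covariance is a linear functional of a product of functions `tanh (localField
i)` on a set of at most `2 ^ s` latent configurations. On `N` points, products of at most `N`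
functions bounded by 1 control longer products of `k` functions up to a factor `3 ^ k`
(`Seminorm.prod_le_of_card_le`). Degree at most `2 ^ s` therefore suffices
(`absCondCov_spinChar_le`), and these covariances are bounded through `ν` (`absCondCov_le_nu`).

The resulting inequality `α² exp(-2γ)^d ≤ γ 3^(d-1) 2^d ν` is stronger than needed;
`two_mul_tauPrime_le` compares constants. -/

/-! ### Two analytic inequalities: products on a finite set, and the slope of `tanh`. -/

/-- If all products of at most `Z.card` of the functions `a i` are small for a seminorm that only
sees the values on the finite set `Z`, then so is the product of all of them. -/
theorem Seminorm.prod_le_of_card_le {ι Y : Type*} [DecidableEq ι] [DecidableEq Y]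
    (a : ι → Y → ℝ) (ha : ∀ i y, |a i y| ≤ 1) (I : Finset ι) :
    ∀ (Z : Finset Y) (p : Seminorm ℝ (Y → ℝ)) (M : ℝ),
      (∀ f : Y → ℝ, (∀ y ∈ Z, f y = 0) → p f = 0) →
      (∀ J ⊆ I, J.card ≤ Z.card → p (∏ i ∈ J, a i) ≤ M) →
      p (∏ i ∈ I, a i) ≤ 3 ^ I.card * M := by
  induction I using Finset.induction_on with
  | empty =>
    intro Z p M _ hM
    simpa using hM ∅ subset_rfl (by simp)
  | insert i I hi ih =>
    intro Z p M hp hM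
    have hM0 : 0 ≤ M := (apply_nonneg p _).trans (hM ∅ (by simp) (by simp))
    rcases Z.eq_empty_or_nonempty with rfl | ⟨y₀, hy₀⟩
    · rw [hp _ (by simp)]
      positivity
    · have h1 := ih Z p M hp fun J hJ hc => hM J (hJ.trans (Finset.subset_insert i I)) hc
      -- Write `a i = a i y₀ + (a i - a i y₀)`. The second factor vanishes at `y₀`, so `p` composed
      -- with multiplication by it sees one point fewer. Its bound doubles to `2 * M`, and `3 ^ k *
      -- M + 3 ^ k * (2 * M) = 3 ^ (k + 1) * M`.
      have h2 := ih (Z.erase y₀)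
        (p.comp (LinearMap.mulLeft ℝ (a i - Function.const Y (a i y₀)))) (2 * M) ?_ ?_
      · have hsplit : ∏ j ∈ insert i I, a j = a i y₀ • ∏ j ∈ I, a j
            + (a i - Function.const Y (a i y₀)) * ∏ j ∈ I, a j := by
          rw [Finset.prod_insert hi]
          ext y
          simp
          ring
        rw [hsplit, Finset.card_insert_of_notMem hi]
        refine (map_add_le_add p _ _).trans ?_
        rw [map_smul_eq_mul, Real.norm_eq_abs]
        have h3 : |a i y₀| * p (∏ j ∈ I, a j) ≤ 1 * (3 ^ I.card * M) :=
          mul_le_mul (ha i y₀) h1 (apply_nonneg p _) zero_le_one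
        simp only [Seminorm.comp_apply, LinearMap.mulLeft_apply] at h2
        rw [pow_succ]
        linarith
      · intro f hf
        rw [Seminorm.comp_apply, LinearMap.mulLeft_apply]
        refine hp _ fun y hy => ?_
        by_cases h : y = y₀
        · simp [h]
        · simp [hf y (Finset.mem_erase.mpr ⟨h, hy⟩)]
      · intro J hJ hc
        -- The point removed from `Z` leaves room for the extra factor `a i` in the product.
        rw [Finset.card_erase_of_mem hy₀] at hc
        have hpos : 0 < Z.card := Finset.card_pos.mpr ⟨y₀, hy₀⟩
        have hiJ : i ∉ J := fun h => hi (hJ h)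
        have hsplit : (a i - Function.const Y (a i y₀)) * ∏ j ∈ J, a j
            = ∏ j ∈ insert i J, a j - a i y₀ • ∏ j ∈ J, a j := by
          rw [Finset.prod_insert hiJ]
          ext y
          simp
          ring
        rw [Seminorm.comp_apply, LinearMap.mulLeft_apply, hsplit]
        refine (map_sub_le_add p _ _).trans ?_
        rw [map_smul_eq_mul, Real.norm_eq_abs]
        have h3 := hM (insert i J) (Finset.insert_subset_insert i hJ)
          (by rw [Finset.card_insert_of_notMem hiJ]; omega)
        have h4 := hM J (hJ.trans (Finset.subset_insert i I)) (by omega)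
        have h5 : |a i y₀| * p (∏ j ∈ J, a j) ≤ 1 * M :=
          mul_le_mul (ha i y₀) h4 (apply_nonneg p _) zero_le_one
        linarith

/-- Mean value theorem: the derivative `1 / cosh ^ 2` of `tanh` is at least `exp (-2 * c)` on `[-c,
c]`, since there `cosh x ≤ exp c`. -/
theorem Real.exp_neg_two_mul_mul_sq_le_mul_tanh_sub {a b c : ℝ} (ha : |a| ≤ c) (hb : |b| ≤ c) :
    Real.exp (-2 * c) * (a - b) ^ 2 ≤ (a - b) * (Real.tanh a - Real.tanh b) := by
  wlog hab : b ≤ a generalizing a b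
  · have := this hb ha (le_of_not_ge hab)
    nlinarith
  have hd : ∀ x : ℝ, HasDerivAt Real.tanh (1 / Real.cosh x ^ 2) x := by
    intro x
    have h := (Real.hasDerivAt_sinh x).div (Real.hasDerivAt_cosh x) (Real.cosh_pos x).ne'
    have he : Real.sinh / Real.cosh = Real.tanh :=
      funext fun y => (Real.tanh_eq_sinh_div_cosh y).symm
    have h' : HasDerivAt Real.tanh _ x := he ▸ h
    convert h' using 1
    rw [← Real.cosh_sq_sub_sinh_sq x]
    ring
  have hmvt : Real.exp (-2 * c) * (a - b) ≤ Real.tanh a - Real.tanh b := by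
    refine (convex_Icc (-c) c).mul_sub_le_image_sub_of_le_deriv
      (fun x _ => (hd x).continuousAt.continuousWithinAt)
      (fun x _ => (hd x).differentiableAt.differentiableWithinAt) (fun x hx => ?_)
      b (abs_le.mp hb) a (abs_le.mp ha) hab
    rw [(hd x).deriv]
    have hx' : |x| ≤ c := abs_le.mpr (Set.Ioo_subset_Icc_self (by simpa using hx))
    have hc : Real.cosh x ≤ Real.exp c := by
      rw [Real.cosh_eq]
      have h1 : Real.exp x ≤ Real.exp c := Real.exp_le_exp.mpr ((le_abs_self x).trans hx')
      have h2 : Real.exp (-x) ≤ Real.exp c := Real.exp_le_exp.mpr ((neg_le_abs x).trans hx')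
      linarith
    have he : Real.exp (-2 * c) = 1 / Real.exp c ^ 2 := by
      rw [← Real.exp_nat_mul, one_div, ← Real.exp_neg]
      congr 1
      push_cast
      ring
    rw [he]
    have := Real.cosh_pos x
    gcongr
  nlinarith [mul_le_mul_of_nonneg_left hmvt (sub_nonneg.mpr hab)]

/-! ### Fourier analysis on the cube. -/

section Spin

variable {n : ℕ}

theorem spinVal_mul (a b : ℤˣ) : spinVal (a * b) = spinVal a * spinVal b := by
  simp [spinVal]

theorem spinVal_one : spinVal 1 = 1 := by simp [spinVal]

theorem spinVal_eq_or (a : ℤˣ) : spinVal a = 1 ∨ spinVal a = -1 := by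
  rcases Int.units_eq_one_or a with rfl | rfl <;> simp [spinVal]

theorem abs_spinVal (a : ℤˣ) : |spinVal a| = 1 := by
  rcases spinVal_eq_or a with h | h <;> simp [h]

theorem spinVal_mul_self (a : ℤˣ) : spinVal a * spinVal a = 1 := by
  rcases spinVal_eq_or a with h | h <;> simp [h]

/-- The configuration which is `-1` at `i` and `1` elsewhere; multiplying by it flips the
spin `i`. -/
def spinFlip (i : Fin n) : SpinConfig n := Pi.mulSingle i (-1)

theorem spinVal_mul_spinFlip_self (x : SpinConfig n) (i : Fin n) :
    spinVal ((x * spinFlip i) i) = -spinVal (x i) := by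
  simp [spinFlip, spinVal]

theorem mul_spinFlip_of_ne (x : SpinConfig n) {i k : Fin n} (h : k ≠ i) :
    (x * spinFlip i) k = x k := by
  simp [spinFlip, Pi.mulSingle_eq_of_ne h]

theorem sum_mul_spinConfig (F : SpinConfig n → ℝ) (c : SpinConfig n) :
    ∑ x, F (x * c) = ∑ x, F x :=
  Equiv.sum_comp (Equiv.mulRight c) F

theorem sum_eq_zero_of_spinFlip (i : Fin n) {F : SpinConfig n → ℝ}
    (h : ∀ x, F (x * spinFlip i) = -F x) : ∑ x, F x = 0 := by
  have h1 := sum_mul_spinConfig F (spinFlip i)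
  simp only [h, Finset.sum_neg_distrib] at h1
  linarith

/-- The tilted, centered spin is odd in `a`, so its sum over a spin flip cancels; this is what makes
`tanh t` the mean of a spin in the field `t`. -/
theorem exp_spinVal_mul_sub_tanh (a : ℤˣ) (t : ℝ) :
    Real.exp (spinVal a * t) * (spinVal a - Real.tanh t) = spinVal a / Real.cosh t := by
  have hc := (Real.cosh_pos t).ne'
  have h1 := Real.cosh_sq_sub_sinh_sq t
  rw [Real.tanh_eq_sinh_div_cosh]
  rcases spinVal_eq_or a with h | h
  · rw [h, one_mul, ← Real.cosh_add_sinh]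
    field_simp
    linear_combination h1
  · rw [h, neg_one_mul, ← Real.cosh_sub_sinh]
    field_simp
    linear_combination -h1

/-- Integrating out the spin `i` under a Gibbs weight replaces it by a hyperbolic tangent. -/
theorem sum_exp_mul_spinVal (i : Fin n) (t r φ : SpinConfig n → ℝ)
    (ht : ∀ x, t (x * spinFlip i) = t x) (hr : ∀ x, r (x * spinFlip i) = r x)
    (hφ : ∀ x, φ (x * spinFlip i) = φ x) :
    ∑ x, Real.exp (spinVal (x i) * t x + r x) * (spinVal (x i) * φ x)
      = ∑ x, Real.exp (spinVal (x i) * t x + r x) * (Real.tanh (t x) * φ x) := by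
  rw [← sub_eq_zero, ← Finset.sum_sub_distrib]
  have hk : ∀ x : SpinConfig n, Real.exp (spinVal (x i) * t x + r x) * (spinVal (x i) * φ x)
      - Real.exp (spinVal (x i) * t x + r x) * (Real.tanh (t x) * φ x)
      = spinVal (x i) / Real.cosh (t x) * (Real.exp (r x) * φ x) := by
    intro x
    rw [← exp_spinVal_mul_sub_tanh, Real.exp_add]
    ring
  simp only [hk]
  refine sum_eq_zero_of_spinFlip i fun x => ?_
  rw [ht, hr, hφ, spinVal_mul_spinFlip_self]
  ring

/-- The monomial `∏ i ∈ T, x i`. -/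
def spinChar (T : Finset (Fin n)) (x : SpinConfig n) : ℝ := ∏ i ∈ T, spinVal (x i)

theorem spinChar_mul (T : Finset (Fin n)) (x y : SpinConfig n) :
    spinChar T (x * y) = spinChar T x * spinChar T y := by
  simp [spinChar, spinVal_mul, Finset.prod_mul_distrib]

theorem abs_spinChar (T : Finset (Fin n)) (x : SpinConfig n) : |spinChar T x| = 1 := by
  simp [spinChar, Finset.abs_prod, abs_spinVal]

theorem spinChar_mul_self (T : Finset (Fin n)) (x : SpinConfig n) :
    spinChar T x * spinChar T x = 1 := by
  rw [← abs_mul_abs_self, abs_spinChar, one_mul]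

theorem spinChar_spinFlip_of_notMem {T : Finset (Fin n)} {i : Fin n} (h : i ∉ T)
    (x : SpinConfig n) : spinChar T (x * spinFlip i) = spinChar T x :=
  Finset.prod_congr rfl fun k hk => by
    rw [mul_spinFlip_of_ne x (ne_of_mem_of_not_mem hk h)]

theorem spinVal_mul_spinChar_erase {T : Finset (Fin n)} {i : Fin n} (h : i ∈ T)
    (x : SpinConfig n) : spinVal (x i) * spinChar (T.erase i) x = spinChar T x :=
  Finset.mul_prod_erase T (fun k => spinVal (x k)) h

theorem spinChar_spinFlip_of_mem {T : Finset (Fin n)} {i : Fin n} (h : i ∈ T)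
    (x : SpinConfig n) : spinChar T (x * spinFlip i) = -spinChar T x := by
  rw [← spinVal_mul_spinChar_erase h, ← spinVal_mul_spinChar_erase h, spinVal_mul_spinFlip_self,
    spinChar_spinFlip_of_notMem (Finset.notMem_erase i T), neg_mul]

theorem sum_mul_spinChar_eq_zero {T : Finset (Fin n)} {i : Fin n} (h : i ∈ T)
    {F : SpinConfig n → ℝ} (hF : ∀ x, F (x * spinFlip i) = F x) :
    ∑ x, F x * spinChar T x = 0 :=
  sum_eq_zero_of_spinFlip i fun x => by rw [hF, spinChar_spinFlip_of_mem h, mul_neg]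

theorem card_spinConfig : Fintype.card (SpinConfig n) = 2 ^ n := by
  simp [SpinConfig]

theorem sum_spinChar_mul_spinChar (T T' : Finset (Fin n)) :
    ∑ x : SpinConfig n, spinChar T x * spinChar T' x = if T = T' then 2 ^ n else 0 := by
  split_ifs with h
  · subst h
    simp [spinChar_mul_self]
  · by_cases hs : T' ⊆ T
    · obtain ⟨i, hi, hi'⟩ : ∃ i ∈ T, i ∉ T' :=
        Finset.not_subset.mp fun h' => h (h'.antisymm hs)
      simp only [mul_comm (spinChar T _)]
      exact sum_mul_spinChar_eq_zero hi (spinChar_spinFlip_of_notMem hi')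
    · obtain ⟨i, hi, hi'⟩ := Finset.not_subset.mp hs
      exact sum_mul_spinChar_eq_zero hi (spinChar_spinFlip_of_notMem hi')

theorem sum_finset_spinChar_mul (x y : SpinConfig n) :
    ∑ T : Finset (Fin n), spinChar T x * spinChar T y = if x = y then 2 ^ n else 0 := by
  have h : ∑ T : Finset (Fin n), spinChar T x * spinChar T y
      = ∏ i, (1 + spinVal (x i) * spinVal (y i)) := by
    rw [Finset.prod_one_add, Finset.powerset_univ]
    exact Finset.sum_congr rfl fun T _ => by simp [spinChar, Finset.prod_mul_distrib]
  rw [h]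
  split_ifs with hxy
  · subst hxy
    simp only [spinVal_mul_self]
    norm_num
  · obtain ⟨i, hi⟩ := Function.ne_iff.mp hxy
    refine Finset.prod_eq_zero (Finset.mem_univ i) ?_
    rcases Int.units_eq_one_or (x i) with h1 | h1 <;>
      rcases Int.units_eq_one_or (y i) with h2 | h2 <;>
      simp_all [spinVal]

/-- Keep the spins in `A` and set the others to `1`. -/
def spinMask (A : Finset (Fin n)) (σ : SpinConfig n) : SpinConfig n :=
  fun i => if i ∈ A then σ i else 1

theorem spinChar_spinMask (A T : Finset (Fin n)) (σ : SpinConfig n) :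
    spinChar T (spinMask A σ) = spinChar (T ∩ A) σ := by
  rw [spinChar, spinChar, ← Finset.filter_mem_eq_inter, Finset.prod_filter]
  exact Finset.prod_congr rfl fun i _ => by
    unfold spinMask
    split_ifs <;> simp [spinVal_one]

end Spin
namespace RBM

variable {n m : ℕ} (B : RBM n m)

/-! ### Fourier expansion of the energy and its support. -/

section Fourier

theorem fourier_eq (T : Finset (Fin n)) :
    B.fourier T = (1 / 2 ^ n) * ∑ x, B.energy x * spinChar T x := rfl

theorem energy_eq_sum_fourier (x : SpinConfig n) :
    B.energy x = ∑ T, B.fourier T * spinChar T x := by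
  have h : ∀ T : Finset (Fin n), B.fourier T * spinChar T x
      = (1 / 2 ^ n) * ∑ y, B.energy y * (spinChar T y * spinChar T x) := by
    intro T
    rw [fourier_eq, mul_assoc, Finset.sum_mul]
    simp only [mul_assoc]
  simp only [h]
  rw [← Finset.mul_sum, Finset.sum_comm]
  simp only [← Finset.mul_sum, sum_finset_spinChar_mul]
  simp only [mul_ite, mul_zero, Finset.sum_ite_eq', Finset.mem_univ, if_true]
  field_simp

/-- Half of the discrete derivative of the energy in direction `u`. -/
noncomputable def influence (u : Fin n) (x : SpinConfig n) : ℝ :=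
  ∑ T : Finset (Fin n) with u ∈ T, B.fourier T * spinChar (T.erase u) x

theorem influence_spinFlip (u : Fin n) (x : SpinConfig n) :
    B.influence u (x * spinFlip u) = B.influence u x :=
  Finset.sum_congr rfl fun T _ => by
    rw [spinChar_spinFlip_of_notMem (Finset.notMem_erase u T)]

/-- The part of the energy which does not depend on `u`. -/
noncomputable def energyOff (u : Fin n) (x : SpinConfig n) : ℝ :=
  ∑ T : Finset (Fin n) with u ∉ T, B.fourier T * spinChar T x

theorem energyOff_spinFlip (u : Fin n) (x : SpinConfig n) :
    B.energyOff u (x * spinFlip u) = B.energyOff u x :=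
  Finset.sum_congr rfl fun T hT => by
    rw [spinChar_spinFlip_of_notMem (Finset.mem_filter.mp hT).2]

theorem energy_eq_influence (u : Fin n) (x : SpinConfig n) :
    B.energy x = spinVal (x u) * B.influence u x + B.energyOff u x := by
  rw [energy_eq_sum_fourier, ← Finset.sum_filter_add_sum_filter_not _ (fun T => u ∈ T),
    influence, energyOff, Finset.mul_sum]
  congr 1
  refine Finset.sum_congr rfl fun T hT => ?_
  rw [← spinVal_mul_spinChar_erase (Finset.mem_filter.mp hT).2]
  ring

theorem sum_abs_fourier_le_width (u : Fin n) :
    ∑ T : Finset (Fin n) with u ∈ T, |B.fourier T| ≤ B.width := by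
  have h := le_ciSup (f := fun u : Fin n => ∑ T : Finset (Fin n) with u ∈ T, |B.fourier T|)
    (Set.finite_range _).bddAbove u
  rw [width]
  convert h

theorem abs_influence_le_width (u : Fin n) (x : SpinConfig n) : |B.influence u x| ≤ B.width := by
  refine (Finset.abs_sum_le_sum_abs _ _).trans (le_trans (le_of_eq ?_)
    (B.sum_abs_fourier_le_width u))
  exact Finset.sum_congr rfl fun T _ => by rw [abs_mul, abs_spinChar, mul_one]

theorem minPotential_le {T : Finset (Fin n)} (hT : T.Nonempty) (h : B.fourier T ≠ 0) :
    B.minPotential ≤ |B.fourier T| :=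
  csInf_le ⟨0, by rintro _ ⟨T, -, -, rfl⟩; exact abs_nonneg _⟩ ⟨T, hT, h, rfl⟩

theorem minPotential_nonneg : 0 ≤ B.minPotential :=
  Real.sInf_nonneg (by rintro _ ⟨T, -, -, rfl⟩; exact abs_nonneg _)

/-- A potential of order at least two is carried by the neighborhood of a latent variable. -/
theorem exists_latent_of_fourier_ne_zero {T : Finset (Fin n)} (hT : 2 ≤ T.card)
    (h : B.fourier T ≠ 0) : ∃ j, ∀ i ∈ T, B.J i j ≠ 0 := by
  by_contra! hno
  refine h ?_
  rw [fourier_eq]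
  refine mul_eq_zero_of_right _ ?_
  simp only [energy, add_mul, Finset.sum_add_distrib, Finset.sum_mul]
  rw [Finset.sum_comm, Finset.sum_comm (f := fun x i => B.h i * spinVal (x i) * spinChar T x)]
  rw [Finset.sum_eq_zero, Finset.sum_eq_zero, add_zero]
  · rintro i -
    -- The external field term depends on the single spin `i`; a second element of `T` is needed to
    -- cancel it by flipping.
    obtain ⟨k, hk, hki⟩ := Finset.exists_mem_ne hT i
    exact sum_mul_spinChar_eq_zero hk fun x => by rw [mul_spinFlip_of_ne x hki.symm]
  · intro j _
    obtain ⟨k, hk, hJ⟩ := hno j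
    refine sum_mul_spinChar_eq_zero hk fun x => ?_
    congr 2
    refine Finset.sum_congr rfl fun i _ => ?_
    by_cases hik : i = k
    · rw [hik, hJ, zero_mul, zero_mul]
    · rw [mul_spinFlip_of_ne x hik]

theorem card_le_latentDegree {T : Finset (Fin n)} (hT : 2 ≤ T.card) (h : B.fourier T ≠ 0) :
    T.card ≤ B.latentDegree := by
  classical
  obtain ⟨j, hj⟩ := B.exists_latent_of_fourier_ne_zero hT h
  refine (Finset.card_le_card fun i hi => ?_).trans (Finset.le_sup (f := fun j : Fin m =>
    (Finset.univ.filter fun i : Fin n => B.J i j ≠ 0).card) (Finset.mem_univ j))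
  exact Finset.mem_filter.mpr ⟨Finset.mem_univ i, hj i hi⟩

theorem mem_nbhd {u i : Fin n} :
    i ∈ B.nbhd u ↔ i ≠ u ∧ ∃ T : Finset (Fin n), u ∈ T ∧ i ∈ T ∧ B.fourier T ≠ 0 := by
  simp [nbhd]

theorem erase_subset_nbhd {u : Fin n} {T : Finset (Fin n)} (hu : u ∈ T) (h : B.fourier T ≠ 0) :
    T.erase u ⊆ B.nbhd u := fun _ hi =>
  B.mem_nbhd.mpr ⟨Finset.ne_of_mem_erase hi, T, hu, Finset.mem_of_mem_erase hi, h⟩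

end Fourier

/-! ### Conditional means and the lower bound on the covariance. -/

section Expectation

/-- The partition function. -/
noncomputable def partitionFn : ℝ := ∑ x : SpinConfig n, Real.exp (B.energy x)

theorem partitionFn_pos : 0 < B.partitionFn :=
  Finset.sum_pos (fun _ _ => Real.exp_pos _) Finset.univ_nonempty

theorem obsProb_eq (x : SpinConfig n) :
    B.obsProb x = Real.exp (B.energy x) / B.partitionFn :=
  B.obsProb_eq_exp_energy x

theorem obsProb_pos (x : SpinConfig n) : 0 < B.obsProb x := by
  rw [obsProb_eq]
  exact div_pos (Real.exp_pos _) B.partitionFn_pos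

theorem sum_obsProb : ∑ x, B.obsProb x = 1 := by
  simp only [obsProb_eq, ← Finset.sum_div]
  exact div_self B.partitionFn_pos.ne'

/-- The expectation of a function of the observed variables. -/
noncomputable def expect (φ : SpinConfig n → ℝ) : ℝ := ∑ x, B.obsProb x * φ x

theorem expect_sub (φ ψ : SpinConfig n → ℝ) :
    B.expect (fun x => φ x - ψ x) = B.expect φ - B.expect ψ := by
  simp only [expect, mul_sub, Finset.sum_sub_distrib]

theorem expect_mono {φ ψ : SpinConfig n → ℝ} (h : ∀ x, φ x ≤ ψ x) : B.expect φ ≤ B.expect ψ :=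
  Finset.sum_le_sum fun x _ => mul_le_mul_of_nonneg_left (h x) (B.obsProb_pos x).le

theorem expect_const_mul (c : ℝ) (φ : SpinConfig n → ℝ) :
    B.expect (fun x => c * φ x) = c * B.expect φ := by
  simp only [expect, Finset.mul_sum, mul_left_comm]

/-- Given the other observed variables, `x u` has mean `tanh (influence u x)`. -/
theorem expect_spinVal_mul (u : Fin n) (φ : SpinConfig n → ℝ)
    (hφ : ∀ x, φ (x * spinFlip u) = φ x) :
    B.expect (fun x => spinVal (x u) * φ x)
      = B.expect (fun x => Real.tanh (B.influence u x) * φ x) := by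
  simp only [expect, obsProb_eq, B.energy_eq_influence u, div_mul_eq_mul_div, ← Finset.sum_div]
  rw [sum_exp_mul_spinVal u _ _ φ (B.influence_spinFlip u) (B.energyOff_spinFlip u) hφ]

/-- The conditional expectation given the observed variables in `S`. -/
noncomputable def condMean (S : Finset (Fin n)) (φ : SpinConfig n → ℝ) (x : SpinConfig n) : ℝ :=
  (∑ x', if S.restrict x' = S.restrict x then B.obsProb x' * φ x' else 0)
    / ∑ x', if S.restrict x' = S.restrict x then B.obsProb x' else 0

theorem condMean_congr (S : Finset (Fin n)) (φ : SpinConfig n → ℝ) {x y : SpinConfig n}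
    (h : S.restrict x = S.restrict y) : B.condMean S φ x = B.condMean S φ y := by
  simp only [condMean, h]

theorem condMean_denom_pos (S : Finset (Fin n)) (x : SpinConfig n) :
    0 < ∑ x', if S.restrict x' = S.restrict x then B.obsProb x' else 0 := by
  refine Finset.sum_pos' (fun y _ => ?_) ⟨x, Finset.mem_univ x, ?_⟩
  · split_ifs
    exacts [(B.obsProb_pos y).le, le_rfl]
  · simpa using B.obsProb_pos x

theorem abs_condMean_le (S : Finset (Fin n)) {φ : SpinConfig n → ℝ} {c : ℝ}
    (h : ∀ x, |φ x| ≤ c) (x : SpinConfig n) : |B.condMean S φ x| ≤ c := by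
  have hpos := B.condMean_denom_pos S x
  rw [condMean, abs_div, abs_of_pos hpos, div_le_iff₀ hpos, Finset.mul_sum]
  refine (Finset.abs_sum_le_sum_abs _ _).trans (Finset.sum_le_sum fun y _ => ?_)
  split_ifs
  · rw [abs_mul, abs_of_pos (B.obsProb_pos y), mul_comm]
    exact mul_le_mul_of_nonneg_right (h y) (B.obsProb_pos y).le
  · simp

/-- Defining property of conditional expectation: the deviation is orthogonal to every function of
`X_S`. -/
theorem expect_sub_condMean_mul (S : Finset (Fin n)) (φ ψ : SpinConfig n → ℝ)
    (hψ : ∀ x y, S.restrict x = S.restrict y → ψ x = ψ y) :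
    B.expect (fun x => (φ x - B.condMean S φ x) * ψ x) = 0 := by
  simp only [sub_mul, expect_sub]
  rw [sub_eq_zero]
  symm
  have h1 : ∀ x, B.obsProb x * (B.condMean S φ x * ψ x)
      = ∑ x', if S.restrict x = S.restrict x' then B.obsProb x' * (φ x' * ψ x')
        * (B.obsProb x / ∑ y, if S.restrict y = S.restrict x' then B.obsProb y else 0) else 0 := by
    intro x
    rw [condMean, div_mul_eq_mul_div, ← mul_div_assoc, ← mul_assoc, mul_comm (B.obsProb x),
      mul_assoc, Finset.sum_mul, Finset.sum_div]
    refine Finset.sum_congr rfl fun x' _ => ?_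
    by_cases h : S.restrict x = S.restrict x'
    · rw [if_pos h.symm, if_pos h, hψ x x' h, h]
      ring
    · rw [if_neg (Ne.symm h), if_neg h]
      simp
  rw [expect, Finset.sum_congr rfl fun x _ => h1 x, Finset.sum_comm]
  refine Finset.sum_congr rfl fun x' _ => ?_
  have h2 := (B.condMean_denom_pos S x').ne'
  rw [← Finset.sum_filter, ← Finset.mul_sum, ← Finset.sum_div, Finset.sum_filter, div_self h2,
    mul_one]

theorem restrict_mul_spinFlip {S : Finset (Fin n)} {i : Fin n} (h : i ∉ S) (x : SpinConfig n) :
    S.restrict (x * spinFlip i) = S.restrict x :=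
  funext fun k => mul_spinFlip_of_ne x (ne_of_mem_of_not_mem k.2 h)

/-- The conditional covariance of the influence on `u` and `x u` dominates the conditional
variance of the influence. -/
theorem exp_mul_expect_sq_le (u : Fin n) {S : Finset (Fin n)} (hu : u ∉ S) :
    Real.exp (-2 * B.width)
        * B.expect (fun x => (B.influence u x - B.condMean S (B.influence u) x) ^ 2)
      ≤ B.expect (fun x => B.influence u x
        * (spinVal (x u) - B.condMean S (fun y => spinVal (y u)) x)) := by
  set g := B.influence u
  set gm := B.condMean S g with hgm
  set c := B.condMean S (fun y => spinVal (y u)) with hc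
  have hgmc : ∀ x y, S.restrict x = S.restrict y → gm x = gm y :=
    fun x y h => B.condMean_congr S g h
  have hcc : ∀ x y, S.restrict x = S.restrict y → c x = c y :=
    fun x y h => B.condMean_congr S _ h
  have h1 := B.expect_sub_condMean_mul S (fun y => spinVal (y u)) gm hgmc
  have h2 := B.expect_sub_condMean_mul S g c hcc
  have h3 := B.expect_sub_condMean_mul S g (fun x => Real.tanh (gm x))
    fun x y h => by rw [hgmc x y h]
  have h4 := B.expect_spinVal_mul u (fun x => g x - gm x) fun x => by
    rw [hgmc _ _ (restrict_mul_spinFlip hu x), show g (x * spinFlip u) = g x from B.influence_spinFlip u x]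
  rw [← hgm] at h2 h3
  rw [← hc] at h1
  -- Functions of `X_S` may be added or removed: subtract `gm` from `g`, drop `c`, replace `X_u` by
  -- `tanh g` (valid since `g - gm` does not involve `x u`), then subtract `tanh gm`.
  have h5 : B.expect (fun x => g x * (spinVal (x u) - c x))
      = B.expect (fun x => (g x - gm x) * (Real.tanh (g x) - Real.tanh (gm x))) := by
    simp only [sub_mul, mul_sub, expect_sub] at h1 h2 h3 h4 ⊢
    have hcomm : ∀ φ ψ : SpinConfig n → ℝ,
        B.expect (fun x => φ x * ψ x) = B.expect (fun x => ψ x * φ x) := fun φ ψ => by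
      simp only [mul_comm]
    have e1 := hcomm g (fun x => spinVal (x u))
    have e2 := hcomm g (fun x => Real.tanh (g x))
    have e3 := hcomm gm (fun x => Real.tanh (g x))
    have e4 := hcomm gm c
    linarith
  rw [h5, ← expect_const_mul]
  exact B.expect_mono fun x => Real.exp_neg_two_mul_mul_sq_le_mul_tanh_sub
    (B.abs_influence_le_width u x)
    (B.abs_condMean_le S (B.abs_influence_le_width u) x)

/-- Flipping `i` changes the energy only through the term `x i * influence`, hence by at most `2γ`.
-/
theorem exp_mul_obsProb_le_spinFlip (i : Fin n) (x : SpinConfig n) :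
    Real.exp (-2 * B.width) * B.obsProb x ≤ B.obsProb (x * spinFlip i) := by
  rw [obsProb_eq, obsProb_eq, ← mul_div_assoc, ← Real.exp_add]
  refine div_le_div_of_nonneg_right (Real.exp_le_exp.mpr ?_) B.partitionFn_pos.le
  rw [B.energy_eq_influence i, B.energy_eq_influence i (x * spinFlip i), B.influence_spinFlip,
    B.energyOff_spinFlip, spinVal_mul_spinFlip_self]
  have h : |spinVal (x i) * B.influence i x| ≤ B.width := by
    rw [abs_mul, abs_spinVal, one_mul]
    exact B.abs_influence_le_width i x
  linarith [(abs_le.mp h).2]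

theorem width_nonneg : 0 ≤ B.width :=
  Real.iSup_nonneg fun _ => Finset.sum_nonneg fun _ _ => abs_nonneg _

/-- The spins of `A` are flipped one at a time; those with `σ i = 1` need no flip and merely waste a
factor at most 1. -/
theorem exp_pow_mul_obsProb_le (A : Finset (Fin n)) (σ x : SpinConfig n) :
    Real.exp (-2 * B.width) ^ A.card * B.obsProb x ≤ B.obsProb (x * spinMask A σ) := by
  induction A using Finset.induction_on with
  | empty =>
    have : spinMask ∅ σ = 1 := by ext; simp [spinMask]
    simp [this]
  | insert i A hi ih =>
    rw [Finset.card_insert_of_notMem hi, pow_succ', mul_assoc]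
    have hle : Real.exp (-2 * B.width) ≤ 1 :=
      Real.exp_le_one_iff.mpr (by linarith [B.width_nonneg])
    refine (mul_le_mul_of_nonneg_left ih (Real.exp_pos _).le).trans ?_
    rcases Int.units_eq_one_or (σ i) with h | h
    · have he : spinMask (insert i A) σ = spinMask A σ := by
        funext k
        by_cases hk : k = i
        · simp [spinMask, hk, h]
        · simp [spinMask, hk]
      rw [he]
      exact mul_le_of_le_one_left (B.obsProb_pos _).le hle
    · have he : x * spinMask (insert i A) σ = x * spinMask A σ * spinFlip i := by
        rw [mul_assoc]
        congr 1
        funext k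
        by_cases hk : k = i
        · subst hk
          simp [spinMask, spinFlip, h, hi]
        · rw [mul_spinFlip_of_ne _ hk]
          simp [spinMask, hk]
      rw [he]
      exact B.exp_mul_obsProb_le_spinFlip i _

/-- Any `T'` surviving the orthogonality relation contains `T`, so maximality leaves `T` alone. -/
theorem sum_influence_mul_spinChar (u : Fin n) {T : Finset (Fin n)} (hu : u ∈ T)
    (hT : ∀ T', T ⊆ T' → B.fourier T' ≠ 0 → T' = T) (x : SpinConfig n) :
    ∑ σ, B.influence u (x * spinMask (T.erase u) σ) * spinChar (T.erase u) σ
      = 2 ^ n * (B.fourier T * spinChar (T.erase u) x) := by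
  simp only [influence, Finset.sum_mul]
  rw [Finset.sum_comm, Finset.sum_eq_single_of_mem T (by simpa using hu)]
  · simp only [spinChar_mul, spinChar_spinMask, Finset.inter_self, mul_assoc, spinChar_mul_self]
    simp
  · intro T' hT' hne
    simp only [spinChar_mul, spinChar_spinMask, mul_assoc]
    rw [← Finset.mul_sum, ← Finset.mul_sum, sum_spinChar_mul_spinChar]
    split_ifs with h
    · have hsub : T ⊆ T' := fun k hk => by
        by_cases hku : k = u
        · rw [hku]
          exact (Finset.mem_filter.mp hT').2
        · exact Finset.mem_of_mem_erase
            (Finset.inter_eq_right.mp h (Finset.mem_erase.mpr ⟨hku, hk⟩))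
      have h0 : B.fourier T' = 0 := by
        by_contra h0
        exact hne (hT T' hsub h0)
      rw [h0, zero_mul]
    · simp

/-- A lower bound for the conditional variance of the influence on `u`. -/
theorem exp_pow_mul_sq_le_expect_sq (u i : Fin n) {T S : Finset (Fin n)} (hu : u ∈ T)
    (hi : i ∈ T.erase u) (hiS : i ∉ S) (hT : ∀ T', T ⊆ T' → B.fourier T' ≠ 0 → T' = T) :
    Real.exp (-2 * B.width) ^ (T.erase u).card * B.fourier T ^ 2
      ≤ B.expect (fun x => (B.influence u x - B.condMean S (B.influence u) x) ^ 2) := by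
  set A := T.erase u
  set h : SpinConfig n → ℝ := fun x => B.influence u x - B.condMean S (B.influence u) x
  set K := Real.exp (-2 * B.width) ^ A.card with hK
  have hK0 : 0 ≤ K := by positivity
  have hcoef : ∀ x, ∑ σ, h (x * spinMask A σ) * spinChar A σ
      = 2 ^ n * (B.fourier T * spinChar A x) := by
    intro x
    simp only [h, sub_mul, Finset.sum_sub_distrib]
    -- The conditional mean ignores the spin `i ∉ S`, so its coefficient at `A` vanishes because `i
    -- ∈ A`.
    rw [B.sum_influence_mul_spinChar u hu hT x, sub_eq_self]
    refine sum_mul_spinChar_eq_zero hi fun σ => B.condMean_congr S _ ?_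
    funext k
    have hk : (k : Fin n) ≠ i := ne_of_mem_of_not_mem k.2 hiS
    simp only [Finset.restrict, Pi.mul_apply, spinMask]
    rw [← Pi.mul_apply, mul_spinFlip_of_ne σ hk]
  have hsq : ∀ x, 2 ^ n * B.fourier T ^ 2 ≤ ∑ σ, h (x * spinMask A σ) ^ 2 := by
    intro x
    have hcs := Finset.sum_mul_sq_le_sq_mul_sq Finset.univ (fun σ => h (x * spinMask A σ))
      (spinChar A)
    rw [hcoef] at hcs
    have h1 : ∑ σ : SpinConfig n, spinChar A σ ^ 2 = 2 ^ n := by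
      simp [sq, spinChar_mul_self]
    have h2 : spinChar A x ^ 2 = 1 := by rw [sq, spinChar_mul_self]
    rw [h1, mul_pow, mul_pow, h2, mul_one] at hcs
    have hp : (0 : ℝ) < 2 ^ n := by positivity
    nlinarith
  -- Change of variables `x ↦ x * spinMask A σ`, paying the density ratio `K`.
  have hσ : ∀ σ, K * ∑ x, B.obsProb x * h (x * spinMask A σ) ^ 2
      ≤ B.expect (fun x => h x ^ 2) := by
    intro σ
    rw [expect, ← sum_mul_spinConfig (fun x => B.obsProb x * h x ^ 2) (spinMask A σ),
      Finset.mul_sum]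
    refine Finset.sum_le_sum fun x _ => ?_
    rw [← mul_assoc]
    exact mul_le_mul_of_nonneg_right (B.exp_pow_mul_obsProb_le A σ x) (sq_nonneg _)
  have hsum := Finset.sum_le_sum fun σ (_ : σ ∈ Finset.univ) => hσ σ
  rw [← Finset.mul_sum, Finset.sum_comm, Finset.sum_const, Finset.card_univ, card_spinConfig,
    nsmul_eq_mul] at hsum
  simp only [← Finset.mul_sum] at hsum
  have hlow : 2 ^ n * B.fourier T ^ 2
      ≤ ∑ x, B.obsProb x * ∑ σ, h (x * spinMask A σ) ^ 2 := by
    calc 2 ^ n * B.fourier T ^ 2 = ∑ x, B.obsProb x * (2 ^ n * B.fourier T ^ 2) := by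
          rw [← Finset.sum_mul, sum_obsProb, one_mul]
      _ ≤ _ := B.expect_mono hsq
  have hfin := (mul_le_mul_of_nonneg_left hlow hK0).trans hsum
  push_cast at hfin
  have hp : (0 : ℝ) < 2 ^ n := by positivity
  refine le_of_mul_le_mul_left ?_ hp
  linarith

end Expectation

end RBM
namespace RBM

variable {n m : ℕ} (B : RBM n m)

/-! ### Conditioning on the latent variables and reduction of the degree. -/

section Latent

/-- The local field acting on the observed variable `i`. -/
noncomputable def localField (i : Fin n) (y : SpinConfig m) : ℝ :=
  B.h i + ∑ j, B.J i j * spinVal (y j)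

theorem weight_eq (x : SpinConfig n) (y : SpinConfig m) (i : Fin n) :
    B.weight x y = Real.exp (spinVal (x i) * B.localField i y
      + ((∑ k ∈ Finset.univ.erase i, spinVal (x k) * B.localField k y)
        + ∑ j, B.g j * spinVal (y j))) := by
  rw [weight, ← add_assoc, Finset.add_sum_erase _ (fun k => spinVal (x k) * B.localField k y)
    (Finset.mem_univ i), ← Finset.sum_add_distrib]
  congr 2
  refine Finset.sum_congr rfl fun k _ => ?_
  rw [localField, mul_add, Finset.mul_sum, add_comm, mul_comm (B.h k)]
  congr 1
  exact Finset.sum_congr rfl fun j _ => mul_assoc _ _ _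

/-- The expectation of a function of all variables. -/
noncomputable def jointExpect (ψ : SpinConfig n → SpinConfig m → ℝ) : ℝ :=
  ∑ x, ∑ y, B.jointProb x y * ψ x y

theorem jointExpect_obs (φ : SpinConfig n → ℝ) :
    B.jointExpect (fun x _ => φ x) = B.expect φ := by
  simp only [jointExpect, expect, ← Finset.sum_mul]
  rfl

/-- For fixed `y` the exponent of the weight is affine in `x i` with slope `localField i y`, so the
spin averages to its `tanh`. -/
theorem jointExpect_spinVal_mul (i : Fin n) (ψ : SpinConfig n → SpinConfig m → ℝ)
    (hψ : ∀ x y, ψ (x * spinFlip i) y = ψ x y) :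
    B.jointExpect (fun x y => spinVal (x i) * ψ x y)
      = B.jointExpect (fun x y => Real.tanh (B.localField i y) * ψ x y) := by
  simp only [jointExpect]
  rw [Finset.sum_comm, Finset.sum_comm (f := fun x y => B.jointProb x y *
    (Real.tanh (B.localField i y) * ψ x y))]
  refine Finset.sum_congr rfl fun y _ => ?_
  simp only [jointProb, div_mul_eq_mul_div, ← Finset.sum_div]
  congr 1
  simp only [B.weight_eq _ y i]
  refine sum_exp_mul_spinVal i (fun _ => B.localField i y) _ (fun x => ψ x y) (fun _ => rfl)
    (fun x => ?_) (fun x => hψ x y)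
  congr 1
  exact Finset.sum_congr rfl fun k hk => by
    rw [mul_spinFlip_of_ne x (Finset.ne_of_mem_erase hk)]

/-- Given the latent variables, the observed variables are independent with means
`tanh (localField i y)`. -/
theorem jointExpect_spinChar_mul (A : Finset (Fin n)) :
    ∀ ψ : SpinConfig n → SpinConfig m → ℝ,
      (∀ i ∈ A, ∀ x y, ψ (x * spinFlip i) y = ψ x y) →
      B.jointExpect (fun x y => spinChar A x * ψ x y)
        = B.jointExpect (fun x y => (∏ i ∈ A, Real.tanh (B.localField i y)) * ψ x y) := by
  induction A using Finset.induction_on with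
  | empty => simp [spinChar]
  | insert i A hi ih =>
    intro ψ hψ
    have h1 := B.jointExpect_spinVal_mul i (fun x y => spinChar A x * ψ x y) fun x y => by
      rw [spinChar_spinFlip_of_notMem hi, hψ i (Finset.mem_insert_self i A)]
    have h2 := ih (fun x y => Real.tanh (B.localField i y) * ψ x y) fun k hk x y => by
      rw [hψ k (Finset.mem_insert_of_mem hk)]
    simp only [spinChar, Finset.prod_insert hi, mul_assoc] at h1 h2 ⊢
    rw [h1]
    simp only [mul_left_comm] at h2 ⊢
    exact h2

/-- The average over `X_S` of the absolute conditional covariance of `φ` and `x u`. -/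
noncomputable def absCondCov (u : Fin n) (S : Finset (Fin n)) (φ : SpinConfig n → ℝ) : ℝ :=
  ∑ z : S → ℤˣ, |B.expect fun x => φ x * if S.restrict x = z then
    spinVal (x u) - B.condMean S (fun y => spinVal (y u)) x else 0|

open Classical in
/-- The latent variables connected to the neighborhood of `u`. -/
noncomputable def adjLatent (u : Fin n) : Finset (Fin m) :=
  {j | ∃ i ∈ B.nbhd u, B.J i j ≠ 0}

theorem card_adjLatent_le (u : Fin n) : (B.adjLatent u).card ≤ B.sparsity := by
  classical
  exact Finset.le_sup (f := fun u : Fin n =>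
    (Finset.univ.filter fun j : Fin m => ∃ i ∈ B.nbhd u, B.J i j ≠ 0).card) (Finset.mem_univ u)

/-- The local field as a function of the latent variables connected to the neighborhood
of `u`. -/
noncomputable def adjField (u i : Fin n) (w : B.adjLatent u → ℤˣ) : ℝ :=
  B.h i + ∑ j : B.adjLatent u, B.J i j * spinVal (w j)

theorem adjField_restrict {u i : Fin n} (hi : i ∈ B.nbhd u) (y : SpinConfig m) :
    B.adjField u i ((B.adjLatent u).restrict y) = B.localField i y := by
  rw [adjField, localField]
  congr 1
  refine (Finset.sum_coe_sort (B.adjLatent u) fun j => B.J i j * spinVal (y j)).trans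
    (Finset.sum_subset (Finset.subset_univ _) fun j _ hj => ?_)
  have : B.J i j = 0 := by
    by_contra h
    exact hj (by simpa [adjLatent] using ⟨i, hi, h⟩)
  rw [this, zero_mul]

/-- The average over `X_S` of the absolute conditional covariance of `x u` and a function of the
latent variables connected to the neighborhood of `u`. -/
noncomputable def latentCov (u : Fin n) (S : Finset (Fin n)) :
    Seminorm ℝ ((B.adjLatent u → ℤˣ) → ℝ) :=
  Seminorm.of
    (fun f => ∑ z : S → ℤˣ, |B.jointExpect fun x y => f ((B.adjLatent u).restrict y) *
      if S.restrict x = z then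
        spinVal (x u) - B.condMean S (fun y => spinVal (y u)) x else 0|)
    (fun f g => by
      rw [← Finset.sum_add_distrib]
      refine Finset.sum_le_sum fun z _ => le_trans (le_of_eq ?_) (abs_add_le _ _)
      simp only [jointExpect, Pi.add_apply, add_mul, mul_add, Finset.sum_add_distrib])
    (fun c f => by
      rw [Finset.mul_sum]
      refine Finset.sum_congr rfl fun z _ => ?_
      rw [Real.norm_eq_abs, ← abs_mul]
      simp only [jointExpect, Pi.smul_apply, smul_eq_mul, Finset.mul_sum, mul_assoc,
        mul_left_comm])

/-- Since `A` avoids both `u` and `S`, the test function is unchanged by flips in `A`, and the spins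
of `A` can be integrated out given `Y`. -/
theorem latentCov_prod {u : Fin n} {S A : Finset (Fin n)} (hA : A ⊆ B.nbhd u)
    (hAS : Disjoint A S) :
    B.latentCov u S (∏ i ∈ A, fun w => Real.tanh (B.adjField u i w))
      = B.absCondCov u S (spinChar A) := by
  refine Finset.sum_congr rfl fun z _ => ?_
  rw [← jointExpect_obs, B.jointExpect_spinChar_mul A]
  · congr 2
    funext x y
    rw [Finset.prod_apply]
    congr 1
    exact Finset.prod_congr rfl fun i hi => by rw [B.adjField_restrict (hA hi)]
  · intro i hi x y
    have hiS : i ∉ S := Finset.disjoint_left.mp hAS hi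
    have hiu : u ≠ i := ((B.mem_nbhd.mp (hA hi)).1).symm
    rw [restrict_mul_spinFlip hiS, mul_spinFlip_of_ne x hiu,
      B.condMean_congr S _ (restrict_mul_spinFlip hiS x)]

/-- Few latent variables reduce covariances with monomials of high degree to covariances with
monomials of low degree. -/
theorem absCondCov_spinChar_le {u : Fin n} {S A : Finset (Fin n)} (hA : A ⊆ B.nbhd u)
    (hAS : Disjoint A S) {M : ℝ}
    (hM : ∀ J ⊆ A, J.card ≤ 2 ^ B.sparsity → B.absCondCov u S (spinChar J) ≤ M) :
    B.absCondCov u S (spinChar A) ≤ 3 ^ A.card * M := by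
  classical
  rw [← B.latentCov_prod hA hAS]
  -- With `Z` the whole space of adjacent latent configurations, locality is trivial and `Z.card` is
  -- at most `2 ^ sparsity`.
  refine Seminorm.prod_le_of_card_le _ (fun i w => (Real.abs_tanh_lt_one _).le) A Finset.univ _ M
    (fun f hf => ?_) fun J hJ hc => ?_
  · have : f = 0 := funext fun w => hf w (Finset.mem_univ w)
    rw [this, map_zero]
  · rw [B.latentCov_prod (hJ.trans hA) (hAS.mono_left hJ)]
    refine hM J hJ (hc.trans ?_)
    rw [Finset.card_univ]
    simpa using Nat.pow_le_pow_right two_pos (B.card_adjLatent_le u)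

end Latent

/-! ### From covariances to `ν`. -/

section Information

theorem prob_eq (E : Set (SpinConfig n)) [DecidablePred (· ∈ E)] :
    B.prob E = ∑ x, if x ∈ E then B.obsProb x else 0 := by
  simp [prob, Set.indicator_apply]

theorem sum_mul_prob {κ : Type*} [Fintype κ] [DecidableEq κ] (X : SpinConfig n → κ) (v : κ → ℝ)
    (F : Set (SpinConfig n)) :
    ∑ k, v k * B.prob ({x | X x = k} ∩ F)
      = B.expect fun x => F.indicator (fun x => v (X x)) x := by
  classical
  simp only [prob_eq, Finset.mul_sum, expect]
  rw [Finset.sum_comm]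
  refine Finset.sum_congr rfl fun x _ => ?_
  by_cases h : x ∈ F <;> simp [h, mul_comm]

/-- For each value of `X_S`, the covariance is a combination with signs `±1` of the discrepancies
averaged in `ν`; the factor `2 ^ (J.card + 1)` undoes the normalization over `R` and `G`. -/
theorem absCondCov_le_nu (u : Fin n) (J S : Finset (Fin n)) :
    B.absCondCov u S (spinChar J) ≤ 2 ^ (J.card + 1) * B.nu u J S := by
  classical
  have hnu : 2 ^ (J.card + 1) * B.nu u J S = ∑ z : S → ℤˣ, ∑ k : ℤˣ × (J → ℤˣ),
      B.prob {x | S.restrict x = z} *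
      |B.condProb {x | x u = k.1 ∧ J.restrict x = k.2} {x | S.restrict x = z}
        - B.condProb {x | x u = k.1} {x | S.restrict x = z}
          * B.condProb {x | J.restrict x = k.2} {x | S.restrict x = z}| := by
    rw [Finset.sum_comm, Fintype.sum_prod_type, nu, ← Finset.mul_sum, pow_succ]
    field_simp
  rw [hnu]
  refine Finset.sum_le_sum fun z _ => ?_
  obtain ⟨x₀, rfl⟩ : ∃ x₀ : SpinConfig n, S.restrict x₀ = z :=
    ⟨fun i => if h : i ∈ S then z ⟨i, h⟩ else 1, by ext i; simp⟩
  set F : Set (SpinConfig n) := {x | S.restrict x = S.restrict x₀} with hF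
  have hP : 0 < B.prob F := by
    rw [prob_eq]
    exact B.condMean_denom_pos S x₀
  set c := B.condMean S (fun y => spinVal (y u)) x₀ with hc
  have e1 := B.sum_mul_prob (fun x => (x u, J.restrict x))
    (fun k : ℤˣ × (J → ℤˣ) => spinVal k.1 * ∏ i, spinVal (k.2 i)) F
  have e2 := B.sum_mul_prob (fun x => x u) spinVal F
  have e3 := B.sum_mul_prob (fun x => J.restrict x)
    (fun G : J → ℤˣ => ∏ i, spinVal (G i)) F
  have hchar : ∀ x : SpinConfig n, ∏ i, spinVal (J.restrict x i) = spinChar J x := fun x =>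
    Finset.prod_coe_sort J fun i => spinVal (x i)
  simp only [hchar] at e1 e3
  have hcF : c * B.prob F = B.expect fun x => F.indicator (fun x => spinVal (x u)) x := by
    rw [hc, condMean, prob_eq]
    refine (div_mul_cancel₀ _ (B.condMean_denom_pos S x₀).ne').trans ?_
    refine Finset.sum_congr rfl fun x _ => ?_
    simp [hF, Set.indicator_apply]
  have hcov : (B.expect fun x => spinChar J x * if S.restrict x = S.restrict x₀ then
      spinVal (x u) - B.condMean S (fun y => spinVal (y u)) x else 0)
      = (B.expect fun x => F.indicator (fun x => spinVal (x u) * spinChar J x) x)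
        - c * B.expect fun x => F.indicator (fun x => spinChar J x) x := by
    rw [← expect_const_mul, ← expect_sub]
    congr 1
    funext x
    by_cases h : S.restrict x = S.restrict x₀
    · rw [if_pos h, Set.indicator_of_mem (show x ∈ F from h),
        Set.indicator_of_mem (show x ∈ F from h), B.condMean_congr S _ h]
      ring
    · rw [if_neg h, Set.indicator_of_notMem (show x ∉ F from h),
        Set.indicator_of_notMem (show x ∉ F from h)]
      ring
  have hsum : (B.expect fun x => F.indicator (fun x => spinVal (x u) * spinChar J x) x)
        - c * (B.expect fun x => F.indicator (fun x => spinChar J x) x)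
      = ∑ k : ℤˣ × (J → ℤˣ), (spinVal k.1 * ∏ i, spinVal (k.2 i)) * (B.prob F *
        (B.condProb {x | x u = k.1 ∧ J.restrict x = k.2} F
          - B.condProb {x | x u = k.1} F * B.condProb {x | J.restrict x = k.2} F)) := by
    have hcd : c = (∑ R, spinVal R * B.prob ({x | x u = R} ∩ F)) / B.prob F := by
      rw [e2, ← hcF, mul_div_cancel_right₀ _ hP.ne']
    rw [← e1, ← e3, hcd, div_mul_eq_mul_div, Finset.sum_mul_sum, ← Fintype.sum_prod_type',
      Finset.sum_div, ← Finset.sum_sub_distrib]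
    refine Finset.sum_congr rfl fun k _ => ?_
    have hset : {x : SpinConfig n | (x u, J.restrict x) = k}
        = {x | x u = k.1 ∧ J.restrict x = k.2} := by
      ext x
      simp [Prod.ext_iff]
    rw [hset, condProb, condProb, condProb]
    field_simp
  rw [hcov, hsum]
  refine (Finset.abs_sum_le_sum_abs _ _).trans (Finset.sum_le_sum fun k _ => ?_)
  rw [abs_mul, abs_mul, abs_mul, Finset.abs_prod, abs_of_pos hP]
  simp [abs_spinVal]

theorem nu_nonneg (u : Fin n) (J S : Finset (Fin n)) : 0 ≤ B.nu u J S := by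
  have h : 0 ≤ B.absCondCov u S (spinChar J) := Finset.sum_nonneg fun _ _ => abs_nonneg _
  exact nonneg_of_mul_nonneg_right (h.trans (B.absCondCov_le_nu u J S)) (by positivity)

/-- The covariance of `x u` and a monomial is controlled by the part of the monomial
outside `S`. -/
theorem abs_expect_spinChar_mul_le (u : Fin n) (S T : Finset (Fin n)) :
    |B.expect fun x => spinChar T x *
        (spinVal (x u) - B.condMean S (fun y => spinVal (y u)) x)|
      ≤ B.absCondCov u S (spinChar (T \ S)) := by
  have hsplit : (B.expect fun x => spinChar T x *
        (spinVal (x u) - B.condMean S (fun y => spinVal (y u)) x))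
      = ∑ z : S → ℤˣ, B.expect fun x => spinChar T x * if S.restrict x = z then
        spinVal (x u) - B.condMean S (fun y => spinVal (y u)) x else 0 := by
    simp only [expect]
    rw [Finset.sum_comm]
    refine Finset.sum_congr rfl fun x _ => ?_
    rw [← Finset.mul_sum, ← Finset.mul_sum]
    simp
  rw [hsplit]
  refine (Finset.abs_sum_le_sum_abs _ _).trans (Finset.sum_le_sum fun z _ => le_of_eq ?_)
  obtain ⟨x₀, rfl⟩ : ∃ x₀ : SpinConfig n, S.restrict x₀ = z :=
    ⟨fun i => if h : i ∈ S then z ⟨i, h⟩ else 1, by ext i; simp⟩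
  -- On the event `X_S = z` the factor `spinChar (T ∩ S)` is a constant sign, which the absolute
  -- value absorbs.
  rw [← one_mul |B.expect fun x => spinChar (T \ S) x * _|, ← abs_spinChar (T ∩ S) x₀, ← abs_mul,
    ← expect_const_mul]
  congr 2
  funext x
  by_cases h : S.restrict x = S.restrict x₀
  · have h1 : spinChar (T ∩ S) x₀ = spinChar (T ∩ S) x :=
      Finset.prod_congr rfl fun i hi => by
        have := congrFun h ⟨i, (Finset.mem_inter.mp hi).2⟩
        simp only [Finset.restrict] at this
        rw [this]
    have h2 : spinChar (T ∩ S) x * spinChar (T \ S) x = spinChar T x :=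
      Finset.prod_inter_mul_prod_sdiff T S fun i => spinVal (x i)
    rw [h1, ← mul_assoc, h2]
  · simp [h]

end Information

/-! ### Assembling the two bounds and comparing constants. -/

/-- Some small set of neighbors outside `S` has large information about `u`. -/
theorem exists_le_nu {u : Fin n} {S : Finset (Fin n)} (hu : u ∉ S) (hS : ¬ B.nbhd u ⊆ S) :
    2 ≤ B.latentDegree ∧ 0 < B.width ∧ ∃ I ⊆ B.nbhd u, Disjoint I S ∧ I.card ≤ 2 ^ B.sparsity ∧
      B.minPotential ^ 2 * Real.exp (-2 * B.width) ^ B.latentDegree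
        ≤ B.width * (3 ^ (B.latentDegree - 1) * (2 ^ B.latentDegree * B.nu u I S)) := by
  classical
  obtain ⟨i, hi, hiS⟩ := Finset.not_subset.mp hS
  obtain ⟨hiu, T₀, huT₀, hiT₀, hT₀⟩ := B.mem_nbhd.mp hi
  -- Largest cardinality among support sets containing `u` and `i` gives maximality under inclusion
  -- in the whole support.
  obtain ⟨T, hTmem, hTmax⟩ := Finset.exists_max_image
    (Finset.univ.filter fun T : Finset (Fin n) => u ∈ T ∧ i ∈ T ∧ B.fourier T ≠ 0)
    Finset.card ⟨T₀, by simp [huT₀, hiT₀, hT₀]⟩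
  obtain ⟨-, huT, hiT, hT⟩ := Finset.mem_filter.mp hTmem
  have hmax : ∀ T', T ⊆ T' → B.fourier T' ≠ 0 → T' = T := fun T' hsub h =>
    (Finset.eq_of_subset_of_card_le hsub
      (hTmax T' (by simp [hsub huT, hsub hiT, h]))).symm
  have hcard2 : 2 ≤ T.card := Finset.one_lt_card.mpr ⟨i, hiT, u, huT, hiu⟩
  have hd : 2 ≤ B.latentDegree := hcard2.trans (B.card_le_latentDegree hcard2 hT)
  have hwidth : 0 < B.width := (abs_pos.mpr hT).trans_le
    ((Finset.single_le_sum (f := fun T => |B.fourier T|) (fun _ _ => abs_nonneg _)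
      (by simpa using huT)).trans (B.sum_abs_fourier_le_width u))
  refine ⟨hd, hwidth, ?_⟩
  -- The maximizer of `ν` bounds all low-degree covariances at once.
  obtain ⟨I, hImem, hImax⟩ := Finset.exists_max_image
    ((B.nbhd u \ S).powerset.filter fun I => I.card ≤ 2 ^ B.sparsity)
    (fun I => B.nu u I S) ⟨∅, by simp⟩
  simp only [Finset.mem_filter, Finset.mem_powerset, Finset.subset_sdiff] at hImem hImax
  refine ⟨I, hImem.1.1, hImem.1.2, hImem.2, ?_⟩
  set M := 3 ^ (B.latentDegree - 1) * (2 ^ B.latentDegree * B.nu u I S) with hMdef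
  have hν := B.nu_nonneg u I S
  set E := Real.exp (-2 * B.width) with hE
  have hE0 : 0 < E := Real.exp_pos _
  have hE1 : E ≤ 1 := Real.exp_le_one_iff.mpr (by linarith)
  have hcov : ∀ T : Finset (Fin n), u ∈ T → B.fourier T ≠ 0 →
      B.absCondCov u S (spinChar (T.erase u \ S)) ≤ M := by
    intro T huT hT
    have hA : T.erase u \ S ⊆ B.nbhd u :=
      Finset.sdiff_subset.trans (B.erase_subset_nbhd huT hT)
    have hAS : Disjoint (T.erase u \ S) S := Finset.sdiff_disjoint
    have hAc : (T.erase u \ S).card ≤ B.latentDegree - 1 := by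
      refine (Finset.card_le_card Finset.sdiff_subset).trans ?_
      rw [Finset.card_erase_of_mem huT]
      -- A singleton `T` need not be carried by a latent variable, but then `T.erase u` is empty.
      by_cases h2 : 2 ≤ T.card
      · exact Nat.sub_le_sub_right (B.card_le_latentDegree h2 hT) 1
      · omega
    refine (B.absCondCov_spinChar_le hA hAS (M := 2 ^ B.latentDegree * B.nu u I S)
      fun J hJ hJc => ?_).trans ?_
    · refine (B.absCondCov_le_nu u J S).trans (mul_le_mul ?_
        (hImax J ⟨⟨hJ.trans hA, hAS.mono_left hJ⟩, hJc⟩) (B.nu_nonneg u J S) (by positivity))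
      refine pow_le_pow_right₀ one_le_two ?_
      have := Finset.card_le_card hJ
      omega
    · exact mul_le_mul_of_nonneg_right (pow_le_pow_right₀ (by norm_num) hAc) (by positivity)
  have hupper : (B.expect fun x => B.influence u x
      * (spinVal (x u) - B.condMean S (fun y => spinVal (y u)) x)) ≤ B.width * M := by
    have hexp : (B.expect fun x => B.influence u x
        * (spinVal (x u) - B.condMean S (fun y => spinVal (y u)) x))
        = ∑ T : Finset (Fin n) with u ∈ T, B.fourier T * B.expect fun x => spinChar (T.erase u) x
          * (spinVal (x u) - B.condMean S (fun y => spinVal (y u)) x) := by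
      simp only [← expect_const_mul]
      simp only [expect, influence, Finset.sum_mul, Finset.mul_sum]
      rw [Finset.sum_comm]
      simp only [mul_assoc]
    rw [hexp]
    refine le_trans ?_ (mul_le_mul_of_nonneg_right (B.sum_abs_fourier_le_width u)
      (by positivity : 0 ≤ M))
    rw [Finset.sum_mul]
    refine Finset.sum_le_sum fun T hT => (le_abs_self _).trans ?_
    rw [abs_mul]
    by_cases h0 : B.fourier T = 0
    · simp [h0]
    · exact mul_le_mul_of_nonneg_left ((B.abs_expect_spinChar_mul_le u S (T.erase u)).trans
        (hcov T (Finset.mem_filter.mp hT).2 h0)) (abs_nonneg _)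
  have hvar := B.exp_pow_mul_sq_le_expect_sq u i huT (Finset.mem_erase.mpr ⟨hiu, hiT⟩) hiS hmax
  have hlower := B.exp_mul_expect_sq_le u hu
  refine le_trans ?_ (hlower.trans hupper)
  refine le_trans ?_ (mul_le_mul_of_nonneg_left hvar hE0.le)
  -- One factor `E` comes from `tanh` and `|T| - 1` from rerandomization; their total `|T|` is at
  -- most `latentDegree`.
  rw [← hE, ← mul_assoc, ← pow_succ', mul_comm, Finset.card_erase_of_mem huT]
  refine mul_le_mul (pow_le_pow_of_le_one hE0.le hE1 ?_) ?_ (by positivity) (by positivity)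
  · have := B.card_le_latentDegree hcard2 hT
    omega
  · rw [← sq_abs (B.fourier T)]
    exact pow_le_pow_left₀ B.minPotential_nonneg (B.minPotential_le ⟨u, huT⟩ hT) 2

theorem two_mul_tauPrime :
    2 * B.tauPrime =
      (1 / (4 * (B.latentDegree : ℝ)) ^ (2 ^ B.sparsity))
        * (1 / (B.latentDegree : ℝ)) ^ (2 ^ B.sparsity * (2 ^ B.sparsity + 1))
        * ((4 * B.minPotential ^ 2
            * Real.exp (-2 * B.width) ^ (B.latentDegree + B.mrfDegree - 1)) /
          ((B.latentDegree : ℝ) ^ (4 * B.latentDegree) * 2 ^ (B.latentDegree + 1)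
            * (B.mrfDegree.choose (B.latentDegree - 1) : ℝ)
            * B.width * Real.exp (2 * B.width))) := by
  rw [tauPrime, tau]
  ring

/-- The factor `1 / (4 * d) ^ (2 ^ s) ≤ 1 / 4` cancels the 4 in the numerator, `3 ≤ 2 ^ 4 ≤ d ^ 4`
absorbs `3 ^ (d - 1)`, and `D ≥ d - 1 ≥ 1` gives both `E ^ (d + D - 1) ≤ E ^ d` and a binomial
coefficient at least 1. -/
theorem two_mul_tauPrime_le (hd : 2 ≤ B.latentDegree) (hw : 0 < B.width)
    (hdD : B.latentDegree - 1 ≤ B.mrfDegree) {ν : ℝ}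
    (h : B.minPotential ^ 2 * Real.exp (-2 * B.width) ^ B.latentDegree
      ≤ B.width * (3 ^ (B.latentDegree - 1) * (2 ^ B.latentDegree * ν))) :
    2 * B.tauPrime ≤ ν := by
  rw [two_mul_tauPrime]
  set d := B.latentDegree
  set D := B.mrfDegree
  set E := Real.exp (-2 * B.width)
  have hE0 : 0 < E := Real.exp_pos _
  have hE1 : E ≤ 1 := Real.exp_le_one_iff.mpr (by linarith)
  have hd' : (2 : ℝ) ≤ d := by exact_mod_cast hd
  have hC : (1 : ℝ) ≤ (D.choose (d - 1) : ℝ) := by exact_mod_cast Nat.choose_pos hdD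
  have hexp : (1 : ℝ) ≤ Real.exp (2 * B.width) := Real.one_le_exp (by linarith)
  have hν : 0 ≤ ν := by
    have h0 : 0 ≤ B.width * (3 ^ (d - 1) * (2 ^ d * ν)) := le_trans (by positivity) h
    have h1 := nonneg_of_mul_nonneg_right h0 hw
    have h2 := nonneg_of_mul_nonneg_right h1 (by positivity)
    exact nonneg_of_mul_nonneg_right h2 (by positivity)
  have hfac1 : 1 / (4 * (d : ℝ)) ^ (2 ^ B.sparsity) ≤ 1 / 4 := by
    refine one_div_le_one_div_of_le (by norm_num) ?_
    exact le_trans (by linarith) (le_self_pow₀ (by linarith) (by positivity))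
  have hfac2 : (1 / (d : ℝ)) ^ (2 ^ B.sparsity * (2 ^ B.sparsity + 1)) ≤ 1 := by
    refine pow_le_one₀ (by positivity) ?_
    rw [div_le_one (by linarith)]
    linarith
  have hnum : 4 * B.minPotential ^ 2 * E ^ (d + D - 1)
      ≤ 4 * (B.width * (3 ^ (d - 1) * (2 ^ d * ν))) := by
    have : E ^ (d + D - 1) ≤ E ^ d := pow_le_pow_of_le_one hE0.le hE1 (by omega)
    nlinarith [mul_le_mul_of_nonneg_left this (sq_nonneg B.minPotential)]
  have h3 : (3 : ℝ) ^ (d - 1) ≤ (d : ℝ) ^ (4 * d) := by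
    calc (3 : ℝ) ^ (d - 1) ≤ 3 ^ d := pow_le_pow_right₀ (by norm_num) (by omega)
      _ ≤ ((d : ℝ) ^ 4) ^ d := by
        refine pow_le_pow_left₀ (by norm_num) ?_ d
        have := pow_le_pow_left₀ (by norm_num) hd' 4
        linarith
      _ = (d : ℝ) ^ (4 * d) := (pow_mul _ _ _).symm
  have hfrac : (4 * B.minPotential ^ 2 * E ^ (d + D - 1)) /
      ((d : ℝ) ^ (4 * d) * 2 ^ (d + 1) * (D.choose (d - 1) : ℝ) * B.width
        * Real.exp (2 * B.width)) ≤ 4 * ν := by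
    have hd0 : (0 : ℝ) < d := by linarith
    have hC0 : (0 : ℝ) < (D.choose (d - 1) : ℝ) := by linarith
    rw [div_le_iff₀ (by positivity)]
    refine hnum.trans ?_
    calc 4 * (B.width * (3 ^ (d - 1) * (2 ^ d * ν)))
        = 4 * ν * ((3 : ℝ) ^ (d - 1) * 2 ^ d * 1 * B.width * 1) := by ring
      _ ≤ _ := by gcongr <;> norm_num
  calc _ ≤ 1 / 4 * 1 * (4 * ν) := by
        refine mul_le_mul (mul_le_mul hfac1 hfac2 (by positivity) (by norm_num)) hfrac
          (by positivity) (by norm_num)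
    _ = ν := by ring

end RBM

theorem theorem3p2 {n m : ℕ} (B : RBM n m) (u : Fin n) (S : Finset (Fin n))
    (huS : u ∉ S) (hS : ¬ B.nbhd u ⊆ S)
    (hdD : B.latentDegree - 1 ≤ B.mrfDegree) :
    (∃ I : Finset (Fin n), I ⊆ B.nbhd u ∧ Disjoint I S ∧ I.card ≤ 2 ^ B.sparsity ∧
      2 * B.tauPrime ≤ B.nu u I S) ∧
    2 * B.tauPrime =
      (1 / (4 * (B.latentDegree : ℝ)) ^ (2 ^ B.sparsity))
        * (1 / (B.latentDegree : ℝ)) ^ (2 ^ B.sparsity * (2 ^ B.sparsity + 1))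
        * ((4 * B.minPotential ^ 2
            * Real.exp (-2 * B.width) ^ (B.latentDegree + B.mrfDegree - 1)) /
          ((B.latentDegree : ℝ) ^ (4 * B.latentDegree) * 2 ^ (B.latentDegree + 1)
            * (B.mrfDegree.choose (B.latentDegree - 1) : ℝ)
            * B.width * Real.exp (2 * B.width))) := by
  refine ⟨?_, B.two_mul_tauPrime⟩
  obtain ⟨hd, hw, I, hI, hIS, hcard, hle⟩ := B.exists_le_nu huS hS
  exact ⟨I, hI, hIS, hcard, B.two_mul_tauPrime_le hd hw hdD hle⟩
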